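/- Let $R$ be a commutative noetherian local ring with residue field $k$. For a finitely generated $R$-module $M$, let $\operatorname{depth} M=\inf\{i\ge 0 : \operatorname{Ext}^i_R(k,M)\ne 0\}$ (so the zero module has depth $\infty$), and write $M^*=\operatorname{Hom}_R(M,R)$. Write $\operatorname{Ext}_R^{>0}(M,R)=0$ if $\operatorname{Ext}_R^i(M,R)=0$ for all $i>0$. A finitely generated $R$-module $M$ is called totally reflexive if the natural map $M\to M^{**}$ is an isomorphism and $\operatorname{Ext}_R^{>0}(M,R)=0=\operatorname{Ext}_R^{>0}(M^*,R)$. Assume that $\operatorname{depth} R>0$. Then the following are equivalent. (1) Every finitely generated $R$-module $M$ with $\operatorname{Ext}_R^{>0}(M,R)=0$ is totally reflexive; that is, $R$ satisfies $(\mathbf{tr})$. (2) Every finitely generated $R$-module $M$ with $\operatorname{Ext}_R^{>0}(M,R)=0$ satisfies $\operatorname{depth} M>0$. In particular, the following question of Araya has an affirmative answer for $R$ if and only if $R$ satisfies $(\mathbf{tr})$: if a local ring $R$ has positive depth and $M$ is a finitely generated $R$-module with $\operatorname{Ext}_R^{>0}(M,R)=0$, must $M$ have positive depth? -/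

import Mathlib

universe u

open CategoryTheory

noncomputable section

/-- `Ext^i_R(M, R) = 0` for all `i > 0`. -/
def ExtPosVanishes (R : Type u) [CommRing R] (M : Type u) [AddCommGroup M] [Module R M] : Prop :=
  ∀ i : ℕ, 0 < i → Subsingleton (Abelian.Ext (ModuleCat.of R M) (ModuleCat.of R R) i)

/-- A (finitely generated) module `M` is totally reflexive if the natural map `M → M**` is
bijective and `Ext^{>0}_R(M, R) = 0 = Ext^{>0}_R(M*, R)`. -/
structure IsTotallyReflexive (R : Type u) [CommRing R] (M : Type u) [AddCommGroup M]
    [Module R M] : Prop where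
  bijective_eval : Function.Bijective (Module.Dual.eval R M)
  ext_vanishes : ExtPosVanishes R M
  ext_dual_vanishes : ExtPosVanishes R (Module.Dual R M)

/-- The condition (tr): every finitely generated module `M` with `Ext^{>0}_R(M, R) = 0` is totally
reflexive. -/
def SatisfiesTR (R : Type u) [CommRing R] : Prop :=
  ∀ (M : Type u) [AddCommGroup M] [Module R M] [Module.Finite R M],
    ExtPosVanishes R M → IsTotallyReflexive R M

/-- The depth of a finitely generated module `M` over a noetherian local ring `R` with residue
field `k`: the infimum in `ℕ ∪ {∞}` of the `i` with `Ext^i_R(k, M) ≠ 0`. In particular the zero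
module has depth `∞`. -/
def moduleDepth (R : Type u) [CommRing R] [IsLocalRing R] (M : Type u) [AddCommGroup M]
    [Module R M] : ℕ∞ :=
  ⨅ (i : ℕ) (_ : Nontrivial
    (Abelian.Ext (ModuleCat.of R (IsLocalRing.ResidueField R)) (ModuleCat.of R M) i)), (i : ℕ∞)

/-- Araya's question for `R` has an affirmative answer: if `R` has positive depth, then every
finitely generated module `M` with `Ext^{>0}_R(M, R) = 0` has positive depth. -/
def ArayaAffirmative (R : Type u) [CommRing R] [IsLocalRing R] : Prop :=
  0 < moduleDepth R R →
    ∀ (M : Type u) [AddCommGroup M] [Module R M] [Module.Finite R M],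
      ExtPosVanishes R M → 0 < moduleDepth R M

end

/-! Only (2) ⟹ (1) is deep. Suppose that `Ext^{>0}(M, R) = 0`, choose `f : M → F` with `F` finite
free and `f*` surjective, and let `K = ker f = ker (M → M**)`. Let `J` be the ideal of scalars whose
action on `M` factors through a finite free module. Noetherian induction on `J`, from larger ideals
to smaller, gives `K = 0`. If `J` contains the maximal ideal, each `r` in that ideal acts on `M` as
some `β ∘ f`, so it kills `K`, and positive depth gives `K = 0`. Otherwise pick `x ∉ J` in the
maximal ideal, regular on `M`. The cokernel of `(f, x) : M → F × M` again has vanishing Ext, and its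
ideal contains `J` and `x`, so it is torsionless by induction. This forces `K = xK`, and Nakayama
finishes (`ker_eval_eq_bot`). Once all such modules are torsionless, `f` is injective and its
cokernel is of the same kind, which yields reflexivity and `Ext^{>0}(M*, R) = 0`. -/

section Ext

/-! ### Ext vanishing along short exact sequences -/

section ShortExact

variable {𝒜 : Type*} [Category 𝒜] [Abelian 𝒜] [HasExt 𝒜] {S : ShortComplex 𝒜}

theorem subsingleton_ext_X₃ (hS : S.ShortExact) (Y : 𝒜) (i : ℕ)
    [Subsingleton (Abelian.Ext S.X₁ Y i)] [Subsingleton (Abelian.Ext S.X₂ Y (i + 1))] :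
    Subsingleton (Abelian.Ext S.X₃ Y (i + 1)) := by
  refine subsingleton_of_forall_eq 0 fun e => ?_
  obtain ⟨a, rfl⟩ := Abelian.Ext.contravariant_sequence_exact₃ hS Y e (Subsingleton.elim _ _)
    (add_comm 1 i)
  rw [Subsingleton.elim a 0, Abelian.Ext.comp_zero]

theorem subsingleton_ext_X₂ (hS : S.ShortExact) (Y : 𝒜) (i : ℕ)
    [Subsingleton (Abelian.Ext S.X₁ Y i)] [Subsingleton (Abelian.Ext S.X₃ Y i)] :
    Subsingleton (Abelian.Ext S.X₂ Y i) := by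
  refine subsingleton_of_forall_eq 0 fun e => ?_
  obtain ⟨c, rfl⟩ := Abelian.Ext.contravariant_sequence_exact₂ hS Y e (Subsingleton.elim _ _)
  rw [Subsingleton.elim c 0, Abelian.Ext.comp_zero]

/-- If every morphism `X₁ ⟶ Y` extends along `X₁ ⟶ X₂`, then `Ext¹(X₂, Y) = 0` forces
`Ext¹(X₃, Y) = 0`. -/
theorem subsingleton_ext_one_X₃ (hS : S.ShortExact) (Y : 𝒜)
    (hext : ∀ φ : S.X₁ ⟶ Y, ∃ ψ : S.X₂ ⟶ Y, S.f ≫ ψ = φ)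
    [Subsingleton (Abelian.Ext S.X₂ Y 1)] :
    Subsingleton (Abelian.Ext S.X₃ Y 1) := by
  refine subsingleton_of_forall_eq 0 fun e => ?_
  obtain ⟨a, rfl⟩ := Abelian.Ext.contravariant_sequence_exact₃ hS Y e (Subsingleton.elim _ _)
    (add_zero 1)
  obtain ⟨φ, rfl⟩ := Abelian.Ext.homEquiv₀.symm.surjective a
  obtain ⟨ψ, rfl⟩ := hext φ
  change hS.extClass.comp (Abelian.Ext.mk₀ _) _ = 0
  rw [← Abelian.Ext.mk₀_comp_mk₀, ← Abelian.Ext.comp_assoc_of_second_deg_zero,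
    ShortComplex.ShortExact.extClass_comp, Abelian.Ext.zero_comp]

end ShortExact

variable {R : Type u} [CommRing R]
  {A B C : Type u} [AddCommGroup A] [Module R A] [AddCommGroup B] [Module R B]
  [AddCommGroup C] [Module R C]

theorem shortExact_moduleCatMk {f : A →ₗ[R] B} {g : B →ₗ[R] C} (hf : Function.Injective f)
    (hg : Function.Surjective g) (hfg : Function.Exact f g) :
    (ShortComplex.moduleCatMk f g hfg.linearMap_comp_eq_zero).ShortExact :=
  ModuleCat.shortComplex_shortExact _ hfg hf hg

theorem ExtPosVanishes.of_projective [Module.Projective R A] : ExtPosVanishes R A := by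
  intro i hi
  obtain ⟨j, rfl⟩ := Nat.exists_eq_succ_of_ne_zero hi.ne'
  have : Projective (ModuleCat.of R A) := (IsProjective.iff_projective A).1 inferInstance
  exact Abelian.Ext.subsingleton_of_projective _ _ _

theorem ExtPosVanishes.prod (hA : ExtPosVanishes R A) (hB : ExtPosVanishes R B) :
    ExtPosVanishes R (A × B) := by
  intro i hi
  have hS := shortExact_moduleCatMk (f := LinearMap.inl R A B) (g := LinearMap.snd R A B)
    LinearMap.inl_injective LinearMap.snd_surjective Function.Exact.inl_snd
  exact @subsingleton_ext_X₂ _ _ _ _ _ hS _ i (hA i hi) (hB i hi)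

/-- If `0 → A → B → C → 0` is exact and `B* → A*` is surjective, then vanishing of `Ext^{>0}(-, R)`
passes from `A` and `B` to `C`. -/
theorem ExtPosVanishes.of_shortExact {f : A →ₗ[R] B} {g : B →ₗ[R] C}
    (hf : Function.Injective f) (hg : Function.Surjective g) (hfg : Function.Exact f g)
    (hext : Function.Surjective f.dualMap)
    (hA : ExtPosVanishes R A) (hB : ExtPosVanishes R B) : ExtPosVanishes R C := by
  intro i hi
  have hS := shortExact_moduleCatMk hf hg hfg
  obtain ⟨j, rfl⟩ := Nat.exists_eq_succ_of_ne_zero hi.ne'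
  rcases Nat.eq_zero_or_pos j with rfl | hj
  · refine @subsingleton_ext_one_X₃ _ _ _ _ _ hS _ (fun φ => ?_) (hB 1 hi)
    obtain ⟨ψ, hψ⟩ := hext φ.hom
    exact ⟨ModuleCat.ofHom ψ, ModuleCat.hom_ext hψ⟩
  · exact @subsingleton_ext_X₃ _ _ _ _ _ hS _ j (hA j hj) (hB _ hi)

end Ext

/-- Only `Ext^0(k, M) = Hom(k, M)` matters, and a map out of `k` amounts to an element killed by the
maximal ideal. -/
theorem moduleDepth_pos_iff {R : Type u} [CommRing R] [IsLocalRing R] {M : Type u}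
    [AddCommGroup M] [Module R M] :
    0 < moduleDepth R M ↔
      ∀ m : M, (∀ r ∈ IsLocalRing.maximalIdeal R, r • m = 0) → m = 0 := by
  constructor
  · intro h m hm
    by_contra hne
    have hker : IsLocalRing.maximalIdeal R ≤ LinearMap.ker (LinearMap.toSpanSingleton R M m) :=
      fun r hr => by simpa using hm r hr
    let φ : IsLocalRing.ResidueField R →ₗ[R] M :=
      (IsLocalRing.maximalIdeal R).liftQ (LinearMap.toSpanSingleton R M m) hker
    have hφ : φ (IsLocalRing.residue R 1) = m := one_smul R m
    have : Nontrivial (Abelian.Ext (ModuleCat.of R (IsLocalRing.ResidueField R))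
        (ModuleCat.of R M) 0) := by
      refine ⟨Abelian.Ext.mk₀ (ModuleCat.ofHom φ), 0, fun h0 => hne ?_⟩
      rw [Abelian.Ext.mk₀_eq_zero_iff] at h0
      rw [← hφ]
      exact LinearMap.congr_fun (congrArg ModuleCat.Hom.hom h0) _
    exact h.ne' (nonpos_iff_eq_zero.1 (iInf₂_le 0 this))
  · intro h
    refine lt_of_lt_of_le zero_lt_one (le_iInf₂ fun i hi => ?_)
    rcases Nat.eq_zero_or_pos i with rfl | hpos
    · exfalso
      refine not_subsingleton_iff_nontrivial.2 hi (subsingleton_of_forall_eq 0 fun e => ?_)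
      obtain ⟨φ, rfl⟩ := Abelian.Ext.homEquiv₀.symm.surjective e
      change Abelian.Ext.mk₀ φ = 0
      rw [Abelian.Ext.mk₀_eq_zero_iff]
      ext x
      refine h _ fun r hr => ?_
      rw [← map_smul]
      obtain ⟨y, rfl⟩ := IsLocalRing.residue_surjective x
      have : r • IsLocalRing.residue R y = 0 := by
        rw [Algebra.smul_def, IsLocalRing.ResidueField.algebraMap_eq,
          (IsLocalRing.residue_eq_zero_iff r).2 hr, zero_mul]
      rw [this, map_zero]
    · exact_mod_cast hpos


/-! ### Left approximations by free modules, and scalars factoring through them -/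

section LeftApproximation

variable {R : Type u} [CommRing R] {M N : Type u} [AddCommGroup M] [Module R M]
  [AddCommGroup N] [Module R N]

/-- The coordinates of `f` are generators of `M*`. -/
theorem exists_dualMap_surjective (R : Type u) [CommRing R] [IsNoetherianRing R] (M : Type u)
    [AddCommGroup M] [Module R M] [Module.Finite R M] :
    ∃ (n : ℕ) (f : M →ₗ[R] (Fin n → R)), Function.Surjective f.dualMap := by
  obtain ⟨n, g, hg⟩ := Module.Finite.exists_fin (R := R) (M := Module.Dual R M)
  refine ⟨n, LinearMap.pi g, ?_⟩
  rw [← LinearMap.range_eq_top, eq_top_iff, ← hg, Submodule.span_le]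
  rintro _ ⟨i, rfl⟩
  exact ⟨LinearMap.proj i, LinearMap.ext fun _ => rfl⟩

theorem mem_ker_eval_iff {n : ℕ} {f : M →ₗ[R] (Fin n → R)} (hf : Function.Surjective f.dualMap)
    (m : M) : m ∈ LinearMap.ker (Module.Dual.eval R M) ↔ f m = 0 := by
  constructor
  · intro h
    ext i
    exact LinearMap.congr_fun h (LinearMap.proj i ∘ₗ f)
  · intro h
    ext φ
    obtain ⟨ψ, rfl⟩ := hf φ
    simp [h]

theorem comp_mem_range_dualTensorHom {n : ℕ} (u : M →ₗ[R] (Fin n → R))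
    (v : (Fin n → R) →ₗ[R] N) : v ∘ₗ u ∈ LinearMap.range (dualTensorHom R M N) := by
  refine ⟨∑ i, (LinearMap.proj i ∘ₗ u) ⊗ₜ[R] v (Pi.single i 1), ?_⟩
  ext m
  simp only [map_sum, LinearMap.sum_apply, dualTensorHom_apply, LinearMap.comp_apply,
    LinearMap.proj_apply, ← map_smul]
  rw [← map_sum]
  congr 1
  exact (pi_eq_sum_univ' (u m)).symm

theorem exists_comp_eq_of_mem_range_dualTensorHom {n : ℕ} {f : M →ₗ[R] (Fin n → R)}
    (hf : Function.Surjective f.dualMap) {h : M →ₗ[R] N}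
    (hh : h ∈ LinearMap.range (dualTensorHom R M N)) :
    ∃ β : (Fin n → R) →ₗ[R] N, β ∘ₗ f = h := by
  obtain ⟨t, rfl⟩ := hh
  induction t with
  | zero => exact ⟨0, by simp⟩
  | tmul φ x =>
    obtain ⟨ψ, rfl⟩ := hf φ
    exact ⟨ψ.smulRight x, by ext; simp⟩
  | add s t hs ht =>
    obtain ⟨β, hβ⟩ := hs
    obtain ⟨γ, hγ⟩ := ht
    exact ⟨β + γ, by rw [LinearMap.add_comp, hβ, hγ, map_add]⟩

/-- The ideal of all `y` such that multiplication by `y` on `M` factors through a free module of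
finite rank. -/
noncomputable def freeFactorIdeal (R : Type u) [CommRing R] (M : Type u) [AddCommGroup M]
    [Module R M] : Ideal R :=
  (LinearMap.range (dualTensorHom R M M)).comap
    (LinearMap.toSpanSingleton R (M →ₗ[R] M) LinearMap.id)

theorem mem_freeFactorIdeal {y : R} :
    y ∈ freeFactorIdeal R M ↔
      y • (LinearMap.id : M →ₗ[R] M) ∈ LinearMap.range (dualTensorHom R M M) :=
  Iff.rfl

theorem exists_isSMulRegular_of_not_le [IsNoetherianRing R] [IsLocalRing R] [Module.Finite R M]
    (hM : 0 < moduleDepth R M) {J : Ideal R} (hJ : ¬ IsLocalRing.maximalIdeal R ≤ J) :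
    ∃ x ∈ IsLocalRing.maximalIdeal R, x ∉ J ∧ IsSMulRegular M x := by
  classical
  by_contra! hx
  let s := insert J (associatedPrimes.finite R M).toFinset
  have hsub : (IsLocalRing.maximalIdeal R : Set R) ⊆
      ⋃ i ∈ (↑s : Set (Ideal R)), (id i : Ideal R) := by
    intro x hxm
    simp only [s, Finset.coe_insert, Set.biUnion_insert, Set.Finite.coe_toFinset]
    by_cases hxJ : x ∈ J
    · exact Or.inl hxJ
    · exact Or.inr ((biUnion_associatedPrimes_eq_compl_regular R M).symm ▸ hx x hxm hxJ :
        x ∈ ⋃ p ∈ associatedPrimes R M, (p : Set R))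
  -- Prime avoidance tolerates the possibly non-prime ideal `J`.
  obtain ⟨p, hp, hle⟩ := (Ideal.subset_union_prime (s := s) (f := id) J J (fun i hi hiJ _ => by
    have : i ∈ associatedPrimes R M := by simpa [s, hiJ] using hi
    exact this.isPrime)).1 hsub
  rcases Finset.mem_insert.1 hp with rfl | hp
  · exact hJ hle
  · have hass : IsAssociatedPrime p M := (Set.Finite.mem_toFinset _).1 hp
    obtain ⟨hprime, m, hm⟩ := isAssociatedPrime_iff.1 hass
    refine hprime.ne_top ?_
    have hm0 : m = 0 := moduleDepth_pos_iff.1 hM m fun r hr => by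
      have hrp := hle hr
      rw [id, hm] at hrp
      simpa [Submodule.mem_colon_singleton] using hrp
    rw [hm, hm0]
    simp [Submodule.colon_eq_top_iff_subset]

/-- Dualizing the right exact sequence of a cokernel gives a left exact sequence. -/
theorem exact_dualMap_mkQ_dualMap (f : M →ₗ[R] N) :
    Function.Exact (LinearMap.range f).mkQ.dualMap f.dualMap := by
  intro φ
  constructor
  · intro h
    have hle : LinearMap.range f ≤ LinearMap.ker φ := by
      rintro _ ⟨m, rfl⟩
      exact LinearMap.congr_fun h m
    exact ⟨(LinearMap.range f).liftQ φ hle, Submodule.liftQ_mkQ _ _ hle⟩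
  · rintro ⟨ψ, rfl⟩
    change (ψ ∘ₗ (LinearMap.range f).mkQ) ∘ₗ f = 0
    rw [LinearMap.comp_assoc, LinearMap.range_mkQ_comp, LinearMap.comp_zero]

end LeftApproximation

/-! ### The cokernel of `(f, x)` -/

section ConeModule

variable {R : Type u} [CommRing R] {M : Type u} [AddCommGroup M] [Module R M]
  {n : ℕ} (f : M →ₗ[R] (Fin n → R)) (x : R)

/-- The map `(f, x) : M → F × M`. -/
def coneInclusion : M →ₗ[R] (Fin n → R) × M := f.prod (x • LinearMap.id)

/-- The cokernel of `(f, x) : M → F × M`. -/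
abbrev ConeModule : Type u := ((Fin n → R) × M) ⧸ LinearMap.range (coneInclusion f x)

variable {f x}

theorem coneInclusion_apply (m : M) : coneInclusion f x m = (f m, x • m) := rfl

theorem coneInclusion_injective (hx : IsSMulRegular M x) :
    Function.Injective (coneInclusion f x) := fun _ _ h => hx (congrArg Prod.snd h)

theorem coneInclusion_dualMap_surjective (hf : Function.Surjective f.dualMap) :
    Function.Surjective (coneInclusion f x).dualMap := by
  intro φ
  obtain ⟨ψ, rfl⟩ := hf φ
  exact ⟨ψ ∘ₗ LinearMap.fst R _ _, LinearMap.ext fun _ => rfl⟩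

theorem ConeModule.extPosVanishes (hf : Function.Surjective f.dualMap) (hx : IsSMulRegular M x)
    (hM : ExtPosVanishes R M) : ExtPosVanishes R (ConeModule f x) :=
  .of_shortExact (coneInclusion_injective hx) (Submodule.mkQ_surjective _)
    (LinearMap.exact_map_mkQ_range _) (coneInclusion_dualMap_surjective hf) hM
    (.prod .of_projective hM)

variable (f x) in
/-- The map from the cone to `F` given by `(a, e) ↦ x a - f e`. -/
def ConeModule.toFree : ConeModule f x →ₗ[R] (Fin n → R) :=
  Submodule.liftQ _ (x • LinearMap.fst R _ _ - f ∘ₗ LinearMap.snd R _ _) (by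
    rintro _ ⟨z, rfl⟩
    simp [coneInclusion_apply])

theorem ConeModule.toFree_mk (a : Fin n → R) (e : M) :
    ConeModule.toFree f x (Submodule.Quotient.mk (a, e)) = x • a - f e := rfl

theorem ConeModule.mem_freeFactorIdeal_self : x ∈ freeFactorIdeal R (ConeModule f x) := by
  rw [mem_freeFactorIdeal]
  convert comp_mem_range_dualTensorHom (ConeModule.toFree f x)
    (Submodule.mkQ (LinearMap.range (coneInclusion f x)) ∘ₗ LinearMap.inl R _ _) using 1
  refine Submodule.linearMap_qext _ (LinearMap.ext fun ⟨a, e⟩ => ?_)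
  -- `(x a - f e, 0)` and `x (a, e)` differ by `(f e, x e)`.
  refine (Submodule.Quotient.eq _).2 ⟨e, ?_⟩
  simp [coneInclusion_apply, ConeModule.toFree_mk]

/-- If `y = β ∘ f` on `M`, then modulo `(f, x)(β a)` the element `y (a, e)` equals `(y a - f (β a),
0) - (0, β (x a - f e))`, and both terms factor through `F`. -/
theorem ConeModule.freeFactorIdeal_le (hf : Function.Surjective f.dualMap) :
    freeFactorIdeal R M ≤ freeFactorIdeal R (ConeModule f x) := by
  intro y hy
  obtain ⟨β, hβ⟩ := exists_comp_eq_of_mem_range_dualTensorHom hf (mem_freeFactorIdeal.1 hy)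
  have hβ' (m : M) : β (f m) = y • m := LinearMap.congr_fun hβ m
  let δ : ConeModule f x →ₗ[R] (Fin n → R) :=
    Submodule.liftQ _ ((y • LinearMap.id - f ∘ₗ β) ∘ₗ LinearMap.fst R _ _) (by
      rintro _ ⟨z, rfl⟩
      simp [coneInclusion_apply, hβ'])
  have hδ (a : Fin n → R) (e : M) :
      δ (Submodule.Quotient.mk (a, e)) = y • a - f (β a) := rfl
  have h₁ := comp_mem_range_dualTensorHom δ
    (Submodule.mkQ (LinearMap.range (coneInclusion f x)) ∘ₗ LinearMap.inl R _ _)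
  have h₂ := comp_mem_range_dualTensorHom (ConeModule.toFree f x)
    (Submodule.mkQ (LinearMap.range (coneInclusion f x)) ∘ₗ LinearMap.inr R _ _ ∘ₗ β)
  rw [mem_freeFactorIdeal]
  convert Submodule.sub_mem _ h₁ h₂ using 1
  refine Submodule.linearMap_qext _ (LinearMap.ext fun ⟨a, e⟩ => ?_)
  refine (Submodule.Quotient.eq _).2 ⟨β a, ?_⟩
  simp [coneInclusion_apply, hδ, ConeModule.toFree_mk, hβ']

/-- If the cone of `(f, x)` is torsionless, then the kernel `K` of `M → M**` satisfies
`K = x K`. -/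
theorem ker_eval_le_smul (hf : Function.Surjective f.dualMap)
    (hE : LinearMap.ker (Module.Dual.eval R (ConeModule f x)) = ⊥) {I : Ideal R} (hx : x ∈ I) :
    LinearMap.ker (Module.Dual.eval R M) ≤ I • LinearMap.ker (Module.Dual.eval R M) := by
  intro y hy
  have h0 : (Submodule.Quotient.mk (0, y) : ConeModule f x) ∈
      LinearMap.ker (Module.Dual.eval R (ConeModule f x)) := by
    ext φ
    exact LinearMap.congr_fun hy (φ ∘ₗ Submodule.mkQ _ ∘ₗ LinearMap.inr R _ _)
  rw [hE, Submodule.mem_bot, Submodule.Quotient.mk_eq_zero] at h0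
  obtain ⟨z, hz⟩ := h0
  have hy' : x • z = y := congrArg Prod.snd hz
  rw [← hy']
  exact Submodule.smul_mem_smul hx ((mem_ker_eval_iff hf z).2 (congrArg Prod.fst hz))

end ConeModule

/-! ### From torsionless to totally reflexive -/

section Torsionless

variable {R : Type u} [CommRing R] [IsNoetherianRing R]

/-- If every finitely generated module with `Ext^{>0}(-, R) = 0` is torsionless, then each such
module embeds in a free module with a cokernel of the same kind. -/
theorem exists_shortExact_of_torsionless
    (h : ∀ (M : Type u) [AddCommGroup M] [Module R M] [Module.Finite R M],
      ExtPosVanishes R M → Function.Injective (Module.Dual.eval R M))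
    (M : Type u) [AddCommGroup M] [Module R M] [Module.Finite R M] (hM : ExtPosVanishes R M) :
    ∃ (n : ℕ) (f : M →ₗ[R] (Fin n → R)), Function.Injective f ∧
      Function.Surjective f.dualMap ∧ ExtPosVanishes R ((Fin n → R) ⧸ LinearMap.range f) := by
  obtain ⟨n, f, hf⟩ := exists_dualMap_surjective R M
  have hinj : Function.Injective f := by
    rw [injective_iff_map_eq_zero]
    intro m hm
    exact (injective_iff_map_eq_zero _).1 (h M hM) m ((mem_ker_eval_iff hf m).2 hm)
  exact ⟨n, f, hinj, hf, .of_shortExact hinj (Submodule.mkQ_surjective _)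
    (LinearMap.exact_map_mkQ_range _) hf hM .of_projective⟩

theorem bijective_eval_of_torsionless
    (h : ∀ (M : Type u) [AddCommGroup M] [Module R M] [Module.Finite R M],
      ExtPosVanishes R M → Function.Injective (Module.Dual.eval R M))
    (M : Type u) [AddCommGroup M] [Module R M] [Module.Finite R M] (hM : ExtPosVanishes R M) :
    Function.Bijective (Module.Dual.eval R M) := by
  refine ⟨h M hM, fun θ => ?_⟩
  obtain ⟨n, f, hinj, hf, hC⟩ := exists_shortExact_of_torsionless h M hM
  obtain ⟨a, ha⟩ := (Module.bijective_dual_eval R (Fin n → R)).2 (θ ∘ₗ f.dualMap)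
  have ha' (φ : Module.Dual R (Fin n → R)) : φ a = θ (f.dualMap φ) := LinearMap.congr_fun ha φ
  -- Functionals on the cokernel of `f` pull back to zero on `M`, so they all vanish on the class of
  -- `a`; the cokernel is torsionless.
  have hmem : (LinearMap.range f).mkQ a = 0 := by
    refine (injective_iff_map_eq_zero _).1 (h _ hC) _ (LinearMap.ext fun ψ => ?_)
    have h0 : f.dualMap (ψ ∘ₗ (LinearMap.range f).mkQ) = 0 := by
      rw [LinearMap.dualMap_apply', LinearMap.comp_assoc, LinearMap.range_mkQ_comp,
        LinearMap.comp_zero]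
    have := ha' (ψ ∘ₗ (LinearMap.range f).mkQ)
    rwa [h0, map_zero] at this
  obtain ⟨z, rfl⟩ := (Submodule.Quotient.mk_eq_zero _).1 hmem
  refine ⟨z, LinearMap.ext fun φ => ?_⟩
  obtain ⟨ψ, rfl⟩ := hf φ
  exact ha' ψ

theorem extPosVanishes_dual_of_torsionless
    (h : ∀ (M : Type u) [AddCommGroup M] [Module R M] [Module.Finite R M],
      ExtPosVanishes R M → Function.Injective (Module.Dual.eval R M))
    (M : Type u) [AddCommGroup M] [Module R M] [Module.Finite R M] (hM : ExtPosVanishes R M) :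
    ExtPosVanishes R (Module.Dual R M) := by
  suffices H : ∀ (i : ℕ) (M : Type u) [AddCommGroup M] [Module R M] [Module.Finite R M],
      ExtPosVanishes R M → Subsingleton
        (Abelian.Ext (ModuleCat.of R (Module.Dual R M)) (ModuleCat.of R R) (i + 1)) by
    intro i hi
    obtain ⟨j, rfl⟩ := Nat.exists_eq_succ_of_ne_zero hi.ne'
    exact H j M hM
  clear! M
  intro i
  induction i with
  | zero =>
    intro M _ _ _ hM
    obtain ⟨n, f, hinj, hf, hC⟩ := exists_shortExact_of_torsionless h M hM
    have hS := shortExact_moduleCatMk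
      (LinearMap.dualMap_injective_of_surjective (LinearMap.range f).mkQ_surjective) hf
      (exact_dualMap_mkQ_dualMap f)
    refine @subsingleton_ext_one_X₃ _ _ _ _ _ hS _ (fun φ => ?_)
      (ExtPosVanishes.of_projective 1 one_pos)
    -- With `C` the cokernel of `f`, the sequence is `0 → C* → F* → M* → 0`. By reflexivity a map
    -- `C* → R` is evaluation at some `c`, and evaluation at a lift of `c` to `F` extends it to
    -- `F*`.
    obtain ⟨c, hc⟩ := (bijective_eval_of_torsionless h _ hC).2 φ.hom
    obtain ⟨a, rfl⟩ := (LinearMap.range f).mkQ_surjective c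
    exact ⟨ModuleCat.ofHom (Module.Dual.eval R _ a), ModuleCat.hom_ext hc⟩
  | succ i ih =>
    intro M _ _ _ hM
    obtain ⟨n, f, hinj, hf, hC⟩ := exists_shortExact_of_torsionless h M hM
    have hS := shortExact_moduleCatMk
      (LinearMap.dualMap_injective_of_surjective (LinearMap.range f).mkQ_surjective) hf
      (exact_dualMap_mkQ_dualMap f)
    -- Dimension shift along the same sequence: the degree drops by one when `M` is replaced by the
    -- cokernel of `f`.
    exact @subsingleton_ext_X₃ _ _ _ _ _ hS _ _ (ih _ hC)
      (ExtPosVanishes.of_projective _ (Nat.succ_pos _))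

end Torsionless

/-! ### Positive depth implies torsionless -/

section Depth

variable {R : Type u} [CommRing R] [IsNoetherianRing R] [IsLocalRing R]

theorem ker_eval_eq_bot
    (h : ∀ (M : Type u) [AddCommGroup M] [Module R M] [Module.Finite R M],
      ExtPosVanishes R M → 0 < moduleDepth R M)
    (J : Ideal R) (M : Type u) [AddCommGroup M] [Module R M] [Module.Finite R M]
    (hJ : freeFactorIdeal R M = J) (hM : ExtPosVanishes R M) :
    LinearMap.ker (Module.Dual.eval R M) = ⊥ := by
  induction J using WellFoundedGT.induction generalizing M with
  | ind J ih =>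
  obtain ⟨n, f, hf⟩ := exists_dualMap_surjective R M
  by_cases hle : IsLocalRing.maximalIdeal R ≤ freeFactorIdeal R M
  · rw [eq_bot_iff]
    intro m hm
    refine moduleDepth_pos_iff.1 (h M hM) m fun r hr => ?_
    obtain ⟨β, hβ⟩ := exists_comp_eq_of_mem_range_dualTensorHom hf (hle hr)
    have := LinearMap.congr_fun hβ m
    rw [LinearMap.comp_apply, (mem_ker_eval_iff hf m).1 hm, map_zero] at this
    exact this.symm
  · obtain ⟨x, hxm, hxJ, hx⟩ := exists_isSMulRegular_of_not_le (h M hM) hle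
    have hE : LinearMap.ker (Module.Dual.eval R (ConeModule f x)) = ⊥ := by
      refine ih _ ?_ (ConeModule f x) rfl (ConeModule.extPosVanishes hf hx hM)
      rw [← hJ]
      exact lt_of_le_of_ne (ConeModule.freeFactorIdeal_le hf)
        fun heq => hxJ (heq ▸ ConeModule.mem_freeFactorIdeal_self)
    exact Submodule.eq_bot_of_le_smul_of_le_jacobson_bot _ _ (IsNoetherian.noetherian _)
      (ker_eval_le_smul hf hE hxm) (IsLocalRing.maximalIdeal_le_jacobson _)

theorem satisfiesTR_of_moduleDepth_pos
    (h : ∀ (M : Type u) [AddCommGroup M] [Module R M] [Module.Finite R M],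
      ExtPosVanishes R M → 0 < moduleDepth R M) : SatisfiesTR R := by
  have hinj : ∀ (M : Type u) [AddCommGroup M] [Module R M] [Module.Finite R M],
      ExtPosVanishes R M → Function.Injective (Module.Dual.eval R M) := fun M _ _ _ hM =>
    LinearMap.ker_eq_bot.1 (ker_eval_eq_bot h _ M rfl hM)
  exact fun M _ _ _ hM => ⟨bijective_eval_of_torsionless hinj M hM, hM,
    extPosVanishes_dual_of_torsionless hinj M hM⟩

end Depth

/-- Functionals send an element killed by the maximal ideal to elements of `R` with the same
property, which are zero. -/
theorem moduleDepth_pos_of_injective_eval {R : Type u} [CommRing R] [IsLocalRing R]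
    (hR : 0 < moduleDepth R R) {M : Type u}
    [AddCommGroup M] [Module R M] (hM : Function.Injective (Module.Dual.eval R M)) :
    0 < moduleDepth R M := by
  rw [moduleDepth_pos_iff] at hR ⊢
  intro m hm
  refine (injective_iff_map_eq_zero _).1 hM m (LinearMap.ext fun φ => hR _ fun r hr => ?_)
  rw [← LinearMap.smul_apply, ← map_smul, hm r hr, map_zero, LinearMap.zero_apply]

theorem theorem3p4 (R : Type u) [CommRing R] [IsNoetherianRing R] [IsLocalRing R]
    (hR : 0 < moduleDepth R R) :
    (SatisfiesTR R ↔
      ∀ (M : Type u) [AddCommGroup M] [Module R M] [Module.Finite R M],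
        ExtPosVanishes R M → 0 < moduleDepth R M) ∧
    (ArayaAffirmative R ↔ SatisfiesTR R) := by
  have key : SatisfiesTR R ↔
      ∀ (M : Type u) [AddCommGroup M] [Module R M] [Module.Finite R M],
        ExtPosVanishes R M → 0 < moduleDepth R M :=
    ⟨fun h M _ _ _ hM => moduleDepth_pos_of_injective_eval hR (h M hM).bijective_eval.1,
      satisfiesTR_of_moduleDepth_pos⟩
  exact ⟨key, fun h => key.2 (h hR), fun h _ => key.1 h⟩
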